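/- Let $d\in\mathbb N$, $s\in(0,1)$, $d>2s$, $m>1$, $\gamma\in[0,2s)\cap[0,d-2s]$, $\gamma_0\in[0,\gamma]$. Let $\rho$ be a measurable weight on $\mathbb R^d$ for which there are constants $0<c<C$ with $c|x|^{-\gamma_0}\le\rho(x)\le C|x|^{-\gamma_0}$ for a.e. $|x|<1$ and $c|x|^{-\gamma}\le\rho(x)\le C|x|^{-\gamma}$ for a.e. $|x|\ge1$, and let $\mu$ be a positive finite Radon measure on $\mathbb R^d$. For $0<r<1$ and $\psi\in C_c^\infty(\mathbb R^d)$ put $$(-\Delta)^r\psi(x)=C_{d,r}\,\mathrm{p.v.}\!\int_{\mathbb R^d}\frac{\psi(x)-\psi(y)}{|x-y|^{d+2r}}\,dy,\qquad C_{d,r}=\frac{4^r\,r\,\Gamma(\tfrac d2+r)}{\pi^{d/2}\,\Gamma(1-r)},$$ and let $\dot H^s(\mathbb R^d)$ be the closure of $C_c^\infty(\mathbb R^d)$ (as a space of functions) with respect to the norm $\|\psi\|_{\dot H^s}^2=\frac{C_{d,s}}2\iint\frac{(\psi(x)-\psi(y))^2}{|x-y|^{d+2s}}\,dx\,dy$.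 For $v\in\dot H^s(\mathbb R^d)$, $(-\Delta)^{s/2}v\in L^2(\mathbb R^d)$ is understood in the sense of distributions. A weak solution of $\rho\,u_t+(-\Delta)^s(u^m)=0$ in $\mathbb R^d\times(0,\infty)$ with $\rho u=\mu$ at $t=0$ is a nonnegative measurable function $u$ on $\mathbb R^d\times(0,\infty)$ such that 1. $u\in L^\infty((0,\infty);L^1_\rho(\mathbb R^d))\cap L^\infty(\mathbb R^d\times(\tau,\infty))$ for all $\tau>0$, where $\|f\|_{1,\rho}=\int_{\mathbb R^d}|f|\,\rho\,dx$; 2. $u^m\in L^2_{\rm loc}((0,\infty);\dot H^s(\mathbb R^d))$; 3. $-\int_0^\infty\!\int_{\mathbb R^d}u\,\varphi_t\,\rho\,dx\,dt+\int_0^\infty\!\int_{\mathbb R^d}(-\Delta)^{s/2}(u^m)\,(-\Delta)^{s/2}\varphi\,dx\,dt=0$ for all $\varphi\in C_c^\infty(\mathbb R^d\times(0,\infty))$; 4. $\operatorname{ess\,lim}_{t\to0}\int_{\mathbb R^d}\phi(x)\,u(x,t)\,\rho(x)\,dx=\int_{\mathbb R^d}\phi\,d\mu$ for all bounded continuous $\phi:\mathbb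 R^d\to\mathbb R$. Then every such weak solution conserves mass: $$\|u(t)\|_{1,\rho}=\int_{\mathbb R^d}u(x,t)\,\rho(x)\,dx=\mu(\mathbb R^d)\qquad\text{for a.e. }t>0.$$ -/

import Mathlib

open MeasureTheory Filter Topology Set
open scoped ContDiff ENNReal

namespace FracPME

noncomputable section

/-- The Euclidean space `ℝ^d`. -/
abbrev E (d : ℕ) : Type := EuclideanSpace ℝ (Fin d)

/-- The normalising constant `C_{d,s}` of the fractional Laplacian,
`C_{d,s} = 4^s s Γ(d/2 + s) / (π^{d/2} Γ(1 - s))` for `0 < s < 1`. -/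
def fracConst (d : ℕ) (s : ℝ) : ℝ :=
  (4 : ℝ) ^ s * s * Real.Gamma ((d : ℝ) / 2 + s) /
    (Real.pi ^ ((d : ℝ) / 2) * Real.Gamma (1 - s))

/-- The space `𝓓(ℝ^d) = C_c^∞(ℝ^d)` of smooth compactly supported functions. -/
def IsTestFun {d : ℕ} (φ : E d → ℝ) : Prop :=
  ContDiff ℝ ∞ φ ∧ HasCompactSupport φ

/-- The fractional Laplacian `(-Δ)^s φ (x)` as a principal value integral
`C_{d,s} lim_{ε → 0+} ∫_{|x - y| > ε} (φ(x) - φ(y)) / |x - y|^{d + 2s} dy`. It is only applied to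
smooth compactly supported functions, for which the limit exists. -/
def fracLap {d : ℕ} (s : ℝ) (φ : E d → ℝ) (x : E d) : ℝ :=
  fracConst d s *
    limUnder (𝓝[>] (0 : ℝ)) fun ε : ℝ =>
      ∫ y in {y : E d | ε < ‖x - y‖}, (φ x - φ y) / ‖x - y‖ ^ ((d : ℝ) + 2 * s)

/-- The squared homogeneous Sobolev norm
`‖v‖²_{Ḣ^s} = (C_{d,s} / 2) ∫∫ (v(x) - v(y))² / |x - y|^{d + 2s} dx dy`, with values in `[0, ∞]`. -/
def hdotNormSq {d : ℕ} (s : ℝ) (v : E d → ℝ) : ℝ≥0∞ :=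
  ENNReal.ofReal (fracConst d s / 2) *
    ∫⁻ x : E d, ∫⁻ y : E d,
      ENNReal.ofReal ((v x - v y) ^ 2 / ‖x - y‖ ^ ((d : ℝ) + 2 * s))

/-- The space `Ḣ^s(ℝ^d)`, the closure of `C_c^∞(ℝ^d)` in the norm above, realised as a space of
functions: `v` is approximated in that norm by test functions which converge to `v` almost
everywhere. The pointwise convergence selects the right function among those that differ by
a constant (a constant has seminorm zero); for `d > 2s` it holds along a subsequence of every
sequence of test functions that is Cauchy in the norm. -/
def MemHdot {d : ℕ} (s : ℝ) (v : E d → ℝ) : Prop :=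
  AEStronglyMeasurable v volume ∧
    ∃ φ : ℕ → E d → ℝ, (∀ n, IsTestFun (φ n)) ∧
      Tendsto (fun n => hdotNormSq s fun x => φ n x - v x) atTop (𝓝 0) ∧
      ∀ᵐ x : E d, Tendsto (fun n => φ n x) atTop (𝓝 (v x))

/-- `g ∈ L²(ℝ^d)` is the fractional Laplacian `(-Δ)^r v` in the sense of distributions:
`∫ v (-Δ)^r ψ dx = ∫ g ψ dx` for all test functions `ψ`. Such a `g` is unique up to null sets. -/
def IsDistribFracLap {d : ℕ} (r : ℝ) (v g : E d → ℝ) : Prop :=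
  MemLp g 2 volume ∧
    ∀ ψ : E d → ℝ, IsTestFun ψ →
      Integrable (fun x => v x * fracLap r ψ x) volume ∧
        ∫ x, v x * fracLap r ψ x = ∫ x, g x * ψ x

/-- The space `L²_loc((0,∞); Ḣ^s(ℝ^d))` for functions of `(x, t)`. -/
def MemL2LocHdot {d : ℕ} (s : ℝ) (v : E d → ℝ → ℝ) : Prop :=
  AEStronglyMeasurable (Function.uncurry v) (volume.restrict (univ ×ˢ Ioi (0 : ℝ))) ∧
    (∀ᵐ t ∂(volume.restrict (Ioi (0 : ℝ))), MemHdot s fun x => v x t) ∧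
    ∀ t₁ t₂ : ℝ, 0 < t₁ → t₁ < t₂ →
      ∫⁻ t in Icc t₁ t₂, hdotNormSq s (fun x => v x t) < (⊤ : ℝ≥0∞)

/-- The space `C_c^∞(ℝ^d × (0,∞))`. -/
def IsSpaceTimeTestFun {d : ℕ} (φ : E d → ℝ → ℝ) : Prop :=
  ContDiff ℝ ∞ (Function.uncurry φ) ∧ HasCompactSupport (Function.uncurry φ) ∧
    tsupport (Function.uncurry φ) ⊆ univ ×ˢ Ioi (0 : ℝ)

/-- The hypotheses on the weight `ρ`: it is Lebesgue measurable and comparable to `|x|^{-γ₀}` in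
the unit ball `B_1` and to `|x|^{-γ}` outside it, almost everywhere. -/
structure IsWeight {d : ℕ} (γ γ₀ : ℝ) (ρ : E d → ℝ) : Prop where
  aemeasurable : AEMeasurable ρ volume
  bounds : ∃ c C : ℝ, 0 < c ∧ c < C ∧
    (∀ᵐ x : E d, ‖x‖ < 1 → c * ‖x‖ ^ (-γ₀) ≤ ρ x ∧ ρ x ≤ C * ‖x‖ ^ (-γ₀)) ∧
    (∀ᵐ x : E d, 1 ≤ ‖x‖ → c * ‖x‖ ^ (-γ) ≤ ρ x ∧ ρ x ≤ C * ‖x‖ ^ (-γ))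

/-- Weak solutions `u` of `ρ u_t + (-Δ)^s (u^m) = 0` in `ℝ^d × (0,∞)` with `ρ u = μ` at `t = 0`.
Only the values of `u` on `ℝ^d × (0,∞)`, up to null sets, matter. -/
structure IsWeakSolution {d : ℕ} (s m : ℝ) (ρ : E d → ℝ) (μ : Measure (E d))
    (u : E d → ℝ → ℝ) : Prop where
  /-- `u` is measurable on `ℝ^d × (0,∞)`. -/
  measurable :
    AEStronglyMeasurable (Function.uncurry u) (volume.restrict (univ ×ˢ Ioi (0 : ℝ)))
  /-- `u` is nonnegative. -/
  nonneg : ∀ᵐ p ∂(volume.restrict ((univ : Set (E d)) ×ˢ Ioi (0 : ℝ))), 0 ≤ u p.1 p.2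
  /-- `u ∈ L^∞((0,∞); L^1_ρ(ℝ^d))`. -/
  bounded_L1 : ∃ M : ℝ, ∀ᵐ t ∂(volume.restrict (Ioi (0 : ℝ))),
    Integrable (fun x => u x t * ρ x) volume ∧ ∫ x, |u x t| * ρ x ≤ M
  /-- `u ∈ L^∞(ℝ^d × (τ,∞))` for all `τ > 0`. -/
  bounded : ∀ τ : ℝ, 0 < τ → ∃ M : ℝ,
    ∀ᵐ p ∂(volume.restrict ((univ : Set (E d)) ×ˢ Ioi τ)), |u p.1 p.2| ≤ M
  /-- `u^m ∈ L²_loc((0,∞); Ḣ^s(ℝ^d))`. -/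
  energy : MemL2LocHdot s fun x t => u x t ^ m
  /-- The weak formulation; `g` is the function `(-Δ)^{s/2}(u^m)`. -/
  weak_eq : ∃ g : E d → ℝ → ℝ,
    AEStronglyMeasurable (Function.uncurry g) (volume.restrict (univ ×ˢ Ioi (0 : ℝ))) ∧
    (∀ᵐ t ∂(volume.restrict (Ioi (0 : ℝ))),
      IsDistribFracLap (s / 2) (fun x => u x t ^ m) (fun x => g x t)) ∧
    ∀ φ : E d → ℝ → ℝ, IsSpaceTimeTestFun φ →
      -(∫ t in Ioi (0 : ℝ), ∫ x, u x t * deriv (fun τ => φ x τ) t * ρ x) +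
        ∫ t in Ioi (0 : ℝ), ∫ x, g x t * fracLap (s / 2) (fun y => φ y t) x = 0
  /-- `ess lim_{t → 0} ρ u(t) = μ`, tested against bounded continuous functions. -/
  initial : ∀ φ : BoundedContinuousFunction (E d) ℝ,
    Tendsto (fun t : ℝ => ∫ x, φ x * (u x t * ρ x)) (ae (volume : Measure ℝ) ⊓ 𝓝[>] 0)
      (𝓝 (∫ x, φ x ∂μ))

end

end FracPME

namespace FracPME

noncomputable section

/-! Test the equation with η(t)χ(εx), χ a cutoff, and let ε → 0. The mass term tends to ∫ η' ∫ uρ dx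
dt. With both operators moved onto the cutoff, the diffusion term is formally ∫ η ∫ u^m
(-Δ)^s[χ(ε·)]. Scaling and the decay of (-Δ)^s χ bound the inner integral by Cε^{2s} ∫ u^m
(1+ε|x|)^{-(d+s)} ≤ Cε^{2s-γ} ∫ u^m (1+|x|)^{-γ}. Where η lives, u ≤ N, and ρ ≥ c(1+|x|)^{-γ}, so
the last integral is at most N^{m-1}/c times the mass (`integrable_rpow_mul_decay`). As γ < 2s, the
diffusion term vanishes: the mass is a.e. constant in time, and the initial condition tested with φ
= 1 identifies the constant.

The delicate point is that (-Δ)^{s/2}χ is not compactly supported, so the distributional definition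
of (-Δ)^{s/2}(u^m) does not apply to it. It is approximated by test functions whose values and
increments decay uniformly like (1+|x|)^{-(d+s)} (`IsTestFun.exists_approx_fracLap`). A second half
Laplacian keeps this decay (`abs_fracLap_le`), and `IsTestFun.exists_abs_integral_mul_fracLap_le`
follows. With r = s/2 the order 2r = s is below 1, so Lipschitz control suffices for absolute
convergence. -/

/-! ### Decaying profiles and the tempered kernel -/

/-- The polynomially decaying profile `(1 + |x|)^{-p}`. -/
def decay {d : ℕ} (p : ℝ) (x : E d) : ℝ := (1 + ‖x‖) ^ (-p)

lemma decay_pos {d : ℕ} (p : ℝ) (x : E d) : 0 < decay p x :=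
  Real.rpow_pos_of_pos (by positivity) _

lemma continuous_decay {d : ℕ} (p : ℝ) : Continuous (decay p : E d → ℝ) :=
  (continuous_const.add continuous_norm).rpow_const fun x => Or.inl (show 1 + ‖x‖ ≠ 0 by positivity)

lemma decay_le_one {d : ℕ} {p : ℝ} (hp : 0 ≤ p) (x : E d) : decay p x ≤ 1 :=
  Real.rpow_le_one_of_one_le_of_nonpos (by linarith [norm_nonneg x]) (by linarith)

lemma rpow_neg_le_mul_decay {d : ℕ} {p a b : ℝ} (hp : 0 ≤ p) (ha : 0 < a) (hb : 0 < b) (x : E d)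
    (h : 1 + ‖x‖ ≤ a * b) : b ^ (-p) ≤ a ^ p * decay p x := by
  have h1 : (a * b) ^ (-p) ≤ decay p x :=
    Real.rpow_le_rpow_of_nonpos (by positivity) h (by linarith)
  rw [Real.mul_rpow ha.le hb.le] at h1
  calc b ^ (-p) = a ^ p * (a ^ (-p) * b ^ (-p)) := by
        rw [← mul_assoc, ← Real.rpow_add ha]; simp
    _ ≤ _ := by gcongr

lemma integrable_decay {d : ℕ} {p : ℝ} (hp : (d : ℝ) < p) :
    Integrable (decay p : E d → ℝ) :=
  integrable_one_add_norm (by simpa using hp)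

lemma integrable_decay_sq {d : ℕ} {p : ℝ} (hp : (d : ℝ) < p) :
    Integrable (fun x : E d => decay p x ^ 2) := by
  have hp0 : 0 ≤ p := (Nat.cast_nonneg d).trans hp.le
  refine (integrable_decay hp).mono' ((continuous_decay p).pow 2).aestronglyMeasurable
    (ae_of_all _ fun x => ?_)
  rw [Real.norm_of_nonneg (by positivity)]
  nlinarith [decay_le_one hp0 x, decay_pos p x]

/-- The singular kernel `|z|^{-p}` tempered near the origin by the gain of a Lipschitz bound. -/
def kern {d : ℕ} (p : ℝ) (z : E d) : ℝ := min 1 ‖z‖ * ‖z‖ ^ (-p)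

lemma kern_nonneg {d : ℕ} (p : ℝ) (z : E d) : 0 ≤ kern p z := by
  unfold kern; positivity

/-- In polar coordinates the density is y^{-2r} near 0, integrable because 2r < 1, and y^{-1-2r} at
infinity. -/
lemma integrable_kern {d : ℕ} (hd : 0 < d) {r : ℝ} (hr : 0 < r) (hr' : 2 * r < 1) :
    Integrable (kern ((d : ℝ) + 2 * r) : E d → ℝ) := by
  have : Nonempty (Fin d) := ⟨⟨0, hd⟩⟩
  have key := integrable_fun_norm_addHaar (E := E d) (volume : Measure (E d))
    (f := fun y : ℝ => min 1 y * y ^ (-((d : ℝ) + 2 * r)))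
  refine key.2 ?_
  have hdim : Module.finrank ℝ (E d) = d := by simp
  rw [hdim]
  have hpow : ∀ y : ℝ, 0 < y → y ^ (d - 1) * y ^ (-((d : ℝ) + 2 * r)) = y ^ (-1 - 2 * r) := by
    intro y hy
    rw [← Real.rpow_natCast, ← Real.rpow_add hy, Nat.cast_sub hd]
    congr 1; push_cast; ring
  rw [← Ioc_union_Ioi_eq_Ioi (zero_le_one' ℝ)]
  refine IntegrableOn.union ?_ ?_
  · have h1 : IntegrableOn (fun y : ℝ => y ^ (-2 * r)) (Ioc 0 1) := by
      rw [← intervalIntegrable_iff_integrableOn_Ioc_of_le zero_le_one]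
      exact intervalIntegral.intervalIntegrable_rpow' (by linarith)
    refine h1.congr_fun (fun y hy => ?_) measurableSet_Ioc
    have hy0 : 0 < y := hy.1
    simp only [smul_eq_mul]
    rw [min_eq_right hy.2, mul_left_comm, hpow y hy0]
    conv_rhs => rw [← Real.rpow_one_add' hy0.le (by linarith)]
    congr 1; ring
  · have h1 : IntegrableOn (fun y : ℝ => y ^ (-1 - 2 * r)) (Ioi 1) :=
      integrableOn_Ioi_rpow_of_lt (by linarith) one_pos
    refine h1.congr_fun (fun y hy => ?_) measurableSet_Ioi
    have hy1 : 1 < y := hy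
    simp only [smul_eq_mul]
    rw [min_eq_left hy1.le, one_mul, hpow y (by linarith)]

/-! ### The decay class and its singular integrals -/

/-- Continuous functions which decay like `(1 + |x|)^{-p}`, together with their local
Lipschitz constants. -/
structure DecayLip {d : ℕ} (p A : ℝ) (f : E d → ℝ) : Prop where
  cont : Continuous f
  bound : ∀ x, |f x| ≤ A * decay p x
  lip : ∀ x y, ‖x - y‖ ≤ 1 → |f x - f y| ≤ A * ‖x - y‖ * decay p x

namespace DecayLip

variable {d : ℕ} {p A : ℝ} {f : E d → ℝ}

lemma const_nonneg (hf : DecayLip p A f) : 0 ≤ A := by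
  have h := (abs_nonneg _).trans (hf.bound 0)
  exact nonneg_of_mul_nonneg_left h (decay_pos p 0)

lemma const_mul (hf : DecayLip p A f) (c : ℝ) : DecayLip p (|c| * A) fun x => c * f x where
  cont := continuous_const.mul hf.cont
  bound x := by
    rw [abs_mul, mul_assoc]
    exact mul_le_mul_of_nonneg_left (hf.bound x) (abs_nonneg c)
  lip x y hxy := by
    rw [← mul_sub, abs_mul, mul_assoc, mul_assoc, ← mul_assoc A]
    exact mul_le_mul_of_nonneg_left (hf.lip x y hxy) (abs_nonneg c)

/-- Multiplication by a bounded Lipschitz function. -/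
lemma mul_left (hf : DecayLip p A f) {χ : E d → ℝ} {L : NNReal} (hχ : LipschitzWith L χ)
    (h1 : ∀ x, |χ x| ≤ 1) : DecayLip p ((1 + L) * A) fun x => χ x * f x where
  cont := hχ.continuous.mul hf.cont
  bound x := by
    rw [abs_mul]
    have hA := hf.const_nonneg
    have := decay_pos p x
    calc |χ x| * |f x| ≤ 1 * (A * decay p x) := by gcongr; exacts [h1 x, hf.bound x]
      _ ≤ (1 + L) * (A * decay p x) := by gcongr; simp
      _ = _ := by ring
  lip x y hxy := by
    have h2 : |χ x - χ y| ≤ L * ‖x - y‖ := by simpa [Real.norm_eq_abs] using hχ.norm_sub_le x y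
    have hA := hf.const_nonneg
    have := decay_pos p x
    calc |χ x * f x - χ y * f y| = |χ y * (f x - f y) + (χ x - χ y) * f x| := by ring_nf
      _ ≤ |χ y| * |f x - f y| + |χ x - χ y| * |f x| := by
        rw [← abs_mul, ← abs_mul]; exact abs_add_le _ _
      _ ≤ 1 * (A * ‖x - y‖ * decay p x) + (L * ‖x - y‖) * (A * decay p x) := by
        gcongr; exacts [h1 y, hf.lip x y hxy, hf.bound x]
      _ = _ := by ring

end DecayLip

/-- The pointwise bound of the singular difference quotient. -/
lemma abs_diffQuot_le {d : ℕ} {p A : ℝ} (hp : 0 < p) {f : E d → ℝ} (hf : DecayLip p A f)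
    (x y : E d) :
    |(f x - f y) / ‖x - y‖ ^ p| ≤
      A * decay p x * ((1 + 2 ^ p) * kern p (x - y) + 3 ^ p * decay p y) := by
  have hA := hf.const_nonneg
  have hdx := decay_pos p x
  have hdy := decay_pos p y
  have hk := kern_nonneg p (x - y)
  have h2 : (0 : ℝ) < 2 ^ p := by positivity
  have h3 : (0 : ℝ) < 3 ^ p := by positivity
  rw [abs_div, abs_of_nonneg (Real.rpow_nonneg (norm_nonneg _) p), div_eq_mul_inv,
    ← Real.rpow_neg (norm_nonneg _)]
  have hz0 : 0 ≤ ‖x - y‖ ^ (-p) := by positivity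
  rcases le_or_gt ‖x - y‖ 1 with hz | hz
  · have hk' : kern p (x - y) = ‖x - y‖ * ‖x - y‖ ^ (-p) := by rw [kern, min_eq_right hz]
    calc |f x - f y| * ‖x - y‖ ^ (-p) ≤ (A * ‖x - y‖ * decay p x) * ‖x - y‖ ^ (-p) := by
          gcongr; exact hf.lip x y hz
      _ = A * decay p x * kern p (x - y) := by rw [hk']; ring
      _ ≤ _ := by gcongr; nlinarith [mul_pos h3 hdy, mul_nonneg h2.le hk]
  · have hk' : kern p (x - y) = ‖x - y‖ ^ (-p) := by rw [kern, min_eq_left hz.le, one_mul]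
    have hxf : |f x| * ‖x - y‖ ^ (-p) ≤ A * decay p x * kern p (x - y) := by
      rw [hk']; gcongr; exact hf.bound x
    have hyf : |f y| * ‖x - y‖ ^ (-p) ≤
        A * decay p x * (2 ^ p * kern p (x - y) + 3 ^ p * decay p y) := by
      -- Decay in x comes from f(y) if |x| ≤ 2|y|, since then 1+|x| ≤ 2(1+|y|). Otherwise it comes
      -- from the kernel: |x-y| > |x|/2 and |x-y| > 1 give 1+|x| ≤ 3|x-y|.
      rcases le_or_gt ‖x‖ (2 * ‖y‖) with hxy | hxy
      · have hw : decay p y ≤ 2 ^ p * decay p x :=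
          rpow_neg_le_mul_decay hp.le two_pos (by positivity) x (by linarith)
        calc |f y| * ‖x - y‖ ^ (-p) ≤ (A * (2 ^ p * decay p x)) * ‖x - y‖ ^ (-p) := by
              gcongr; exact (hf.bound y).trans (by gcongr)
          _ = A * decay p x * (2 ^ p * kern p (x - y)) := by rw [hk']; ring
          _ ≤ _ := by gcongr; nlinarith [mul_pos h3 hdy]
      · have hw : ‖x - y‖ ^ (-p) ≤ 3 ^ p * decay p x :=
          rpow_neg_le_mul_decay hp.le three_pos (by linarith) x (by
            linarith [norm_sub_norm_le x y])
        calc |f y| * ‖x - y‖ ^ (-p) ≤ (A * decay p y) * (3 ^ p * decay p x) := by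
              gcongr; exact hf.bound y
          _ = A * decay p x * (3 ^ p * decay p y) := by ring
          _ ≤ _ := by gcongr; nlinarith [mul_nonneg h2.le hk]
    calc |f x - f y| * ‖x - y‖ ^ (-p) ≤ (|f x| + |f y|) * ‖x - y‖ ^ (-p) := by
          gcongr; exact abs_sub _ _
      _ ≤ _ := by rw [add_mul]; refine (add_le_add hxf hyf).trans (le_of_eq (by ring))

lemma measurable_diffQuot {d : ℕ} (p : ℝ) {f : E d → ℝ} (hf : Continuous f) (x : E d) :
    Measurable fun y => (f x - f y) / ‖x - y‖ ^ p := by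
  have := hf.measurable
  fun_prop

lemma integrable_diffQuot_bound {d : ℕ} (hd : 0 < d) {r : ℝ} (hr : 0 < r) (hr' : 2 * r < 1)
    (a b c : ℝ) (x : E d) :
    Integrable (fun y => c * (a * kern ((d : ℝ) + 2 * r) (x - y) +
      b * decay ((d : ℝ) + 2 * r) y)) := by
  refine (Integrable.add (Integrable.const_mul ?_ _) (Integrable.const_mul ?_ _)).const_mul _
  · exact (integrable_kern hd hr hr').comp_sub_left x
  · exact integrable_decay (by linarith)

lemma integrable_diffQuot {d : ℕ} (hd : 0 < d) {r : ℝ} (hr : 0 < r) (hr' : 2 * r < 1)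
    {A : ℝ} {f : E d → ℝ} (hf : DecayLip ((d : ℝ) + 2 * r) A f) (x : E d) :
    Integrable (fun y => (f x - f y) / ‖x - y‖ ^ ((d : ℝ) + 2 * r)) :=
  (integrable_diffQuot_bound hd hr hr' _ _ _ x).mono'
    (measurable_diffQuot _ hf.cont x).aestronglyMeasurable
    (ae_of_all _ fun y => abs_diffQuot_le (by positivity) hf x y)

/-- The constant in the decay estimate for singular integrals. -/
def decayConst (d : ℕ) (r : ℝ) : ℝ :=
  (1 + 2 ^ ((d : ℝ) + 2 * r)) * (∫ z : E d, kern ((d : ℝ) + 2 * r) z) +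
    3 ^ ((d : ℝ) + 2 * r) * ∫ z : E d, decay ((d : ℝ) + 2 * r) z

lemma decayConst_nonneg (d : ℕ) (r : ℝ) : 0 ≤ decayConst d r := by
  have h1 : 0 ≤ ∫ z : E d, kern ((d : ℝ) + 2 * r) z := integral_nonneg fun z => kern_nonneg _ z
  have h2 : 0 ≤ ∫ z : E d, decay ((d : ℝ) + 2 * r) z :=
    integral_nonneg fun z => (decay_pos _ z).le
  unfold decayConst
  have : (0 : ℝ) ≤ 2 ^ ((d : ℝ) + 2 * r) := by positivity
  have : (0 : ℝ) ≤ 3 ^ ((d : ℝ) + 2 * r) := by positivity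
  exact add_nonneg (mul_nonneg (by linarith) h1) (mul_nonneg this h2)

lemma abs_setIntegral_diffQuot_le {d : ℕ} (hd : 0 < d) {r : ℝ} (hr : 0 < r) (hr' : 2 * r < 1)
    {A : ℝ} {f : E d → ℝ} (hf : DecayLip ((d : ℝ) + 2 * r) A f) (x : E d) (S : Set (E d)) :
    |∫ y in S, (f x - f y) / ‖x - y‖ ^ ((d : ℝ) + 2 * r)| ≤
      decayConst d r * A * decay ((d : ℝ) + 2 * r) x := by
  have hint := integrable_diffQuot hd hr hr' hf x
  have hk := (integrable_kern hd hr hr').comp_sub_left x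
  have hw := integrable_decay (d := d) (p := (d : ℝ) + 2 * r) (by linarith)
  rw [← Real.norm_eq_abs]
  calc _ ≤ ∫ y in S, ‖(f x - f y) / ‖x - y‖ ^ ((d : ℝ) + 2 * r)‖ :=
        norm_integral_le_integral_norm _
    _ ≤ ∫ y, ‖(f x - f y) / ‖x - y‖ ^ ((d : ℝ) + 2 * r)‖ :=
        setIntegral_le_integral hint.norm (ae_of_all _ fun y => norm_nonneg _)
    _ ≤ ∫ y, A * decay ((d : ℝ) + 2 * r) x * ((1 + 2 ^ ((d : ℝ) + 2 * r)) *
          kern ((d : ℝ) + 2 * r) (x - y) + 3 ^ ((d : ℝ) + 2 * r) * decay ((d : ℝ) + 2 * r) y) :=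
        integral_mono hint.norm (integrable_diffQuot_bound hd hr hr' _ _ _ x)
          fun y => abs_diffQuot_le (by positivity) hf x y
    _ = _ := by
        rw [integral_const_mul, integral_add (hk.const_mul _) (hw.const_mul _),
          integral_const_mul, integral_const_mul,
          integral_sub_left_eq_self (fun z : E d => kern ((d : ℝ) + 2 * r) z) volume x,
          decayConst]
        ring

/-- Integrals over the complements of shrinking balls exhaust the full singular integral. -/
lemma tendsto_truncated {d : ℕ} (hd : 0 < d) {r : ℝ} (hr : 0 < r) (hr' : 2 * r < 1)
    {A : ℝ} {f : E d → ℝ} (hf : DecayLip ((d : ℝ) + 2 * r) A f) (x : E d) :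
    Tendsto (fun ε : ℝ => ∫ y in {y : E d | ε < ‖x - y‖},
      (f x - f y) / ‖x - y‖ ^ ((d : ℝ) + 2 * r)) (𝓝[>] 0)
      (𝓝 (∫ y, (f x - f y) / ‖x - y‖ ^ ((d : ℝ) + 2 * r))) := by
  have hint := integrable_diffQuot hd hr hr' hf x
  have hS : ∀ ε : ℝ, MeasurableSet {y : E d | ε < ‖x - y‖} := fun ε =>
    measurableSet_lt measurable_const (by fun_prop)
  simp_rw [← fun ε => integral_indicator (μ := volume) (f := fun y : E d =>
    (f x - f y) / ‖x - y‖ ^ ((d : ℝ) + 2 * r)) (hS ε)]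
  refine tendsto_integral_filter_of_dominated_convergence _ ?_ ?_ hint.norm ?_
  · exact Eventually.of_forall fun ε => hint.aestronglyMeasurable.indicator (hS ε)
  · exact Eventually.of_forall fun ε => ae_of_all _ fun y => norm_indicator_le_norm_self _ _
  · refine ae_of_all _ fun y => ?_
    rcases eq_or_ne x y with rfl | hxy
    · refine tendsto_const_nhds.congr fun ε => ?_
      simp [indicator]
    · have hpos : 0 < ‖x - y‖ := norm_pos_iff.2 (sub_ne_zero.2 hxy)
      refine tendsto_const_nhds.congr' ?_
      filter_upwards [Ioo_mem_nhdsGT hpos] with ε hε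
      rw [indicator_of_mem (show y ∈ {y : E d | ε < ‖x - y‖} from hε.2)]

lemma fracLap_eq {d : ℕ} (hd : 0 < d) {r : ℝ} (hr : 0 < r) (hr' : 2 * r < 1)
    {A : ℝ} {f : E d → ℝ} (hf : DecayLip ((d : ℝ) + 2 * r) A f) (x : E d) :
    fracLap r f x = fracConst d r * ∫ y, (f x - f y) / ‖x - y‖ ^ ((d : ℝ) + 2 * r) := by
  rw [fracLap, (tendsto_truncated hd hr hr' hf x).limUnder_eq]

lemma abs_fracLap_le {d : ℕ} (hd : 0 < d) {r : ℝ} (hr : 0 < r) (hr' : 2 * r < 1)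
    {A : ℝ} {f : E d → ℝ} (hf : DecayLip ((d : ℝ) + 2 * r) A f) (x : E d) :
    |fracLap r f x| ≤ |fracConst d r| * (decayConst d r * A) * decay ((d : ℝ) + 2 * r) x := by
  rw [fracLap_eq hd hr hr' hf, abs_mul, mul_assoc]
  have := abs_setIntegral_diffQuot_le hd hr hr' hf x univ
  rw [setIntegral_univ] at this
  gcongr

/-! ### Test functions in the decay class -/

/-- Bounded Lipschitz functions with support in a fixed ball decay as fast as we like. -/
lemma DecayLip.of_support {d : ℕ} {p R B : ℝ} (hp : 0 ≤ p) (hR : 0 ≤ R) {f : E d → ℝ}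
    (hc : Continuous f) (hB : ∀ x, |f x| ≤ B) (hL : ∀ x y, |f x - f y| ≤ B * ‖x - y‖)
    (hsupp : ∀ x, R < ‖x‖ → f x = 0) : DecayLip p ((2 + R) ^ p * B) f := by
  have hB0 : 0 ≤ B := (abs_nonneg _).trans (hB 0)
  -- The margin 1 is for increments: if |x| > R+1 and |x-y| ≤ 1, then f vanishes at both points.
  have hone : ∀ x : E d, ‖x‖ ≤ R + 1 → 1 ≤ (2 + R) ^ p * decay p x := fun x hx => by
    simpa using rpow_neg_le_mul_decay (d := d) hp (a := 2 + R) (b := 1) (by linarith) one_pos x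
      (by linarith)
  have hnn : ∀ x : E d, 0 ≤ (2 + R) ^ p * decay p x := fun x =>
    mul_nonneg (by positivity) (decay_pos p x).le
  refine ⟨hc, fun x => ?_, fun x y hxy => ?_⟩
  · rcases le_or_gt ‖x‖ (R + 1) with hx | hx
    · have := hone x hx
      nlinarith [hB x]
    · rw [hsupp x (by linarith), abs_zero]
      nlinarith [mul_nonneg (hnn x) hB0]
  · rcases le_or_gt ‖x‖ (R + 1) with hx | hx
    · have := hone x hx
      nlinarith [hL x y, mul_nonneg hB0 (norm_nonneg (x - y))]
    · have hy : R < ‖y‖ := by linarith [norm_sub_norm_le x y]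
      rw [hsupp x (by linarith), hsupp y hy, sub_zero, abs_zero]
      nlinarith [mul_nonneg (hnn x) (mul_nonneg hB0 (norm_nonneg (x - y)))]

/-- Test functions, and their difference quotients in any direction, decay uniformly. -/
lemma IsTestFun.exists_decayLip {d : ℕ} {ψ : E d → ℝ} (hψ : IsTestFun ψ) {p : ℝ} (hp : 0 ≤ p) :
    ∃ A : ℝ, DecayLip p A ψ ∧
      ∀ e : E d, ‖e‖ ≤ 1 → DecayLip p (A * ‖e‖) fun x => ψ x - ψ (x - e) := by
  obtain ⟨hsm, hcs⟩ := hψ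
  obtain ⟨L, hL⟩ := hsm.lipschitzWith_of_hasCompactSupport hcs (by simp)
  -- The Lipschitz constant of the gradient makes the increment ψ - ψ(· - e) Lipschitz with a
  -- constant proportional to |e|.
  have hsm' : ContDiff ℝ ∞ (fderiv ℝ ψ) := hsm.fderiv_right (by simp)
  obtain ⟨L', hL'⟩ := hsm'.lipschitzWith_of_hasCompactSupport (hcs.fderiv ℝ) (by simp)
  obtain ⟨B, hB⟩ := hcs.exists_bound_of_continuous hsm.continuous
  obtain ⟨R, hR0, hR⟩ := hcs.isCompact.isBounded.exists_pos_norm_le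
  have hzero : ∀ x, R < ‖x‖ → ψ x = 0 := fun x hx => by
    by_contra h
    exact absurd (hR x (subset_tsupport _ h)) (not_le.2 hx)
  have hLip : ∀ x y, |ψ x - ψ y| ≤ L * ‖x - y‖ := fun x y => hL.norm_sub_le x y
  set M : ℝ := max B (max L L') with hM
  have hM1 : B ≤ M := le_max_left _ _
  have hM2 : (L : ℝ) ≤ M := (le_max_left _ _).trans (le_max_right _ _)
  have hM3 : (L' : ℝ) ≤ M := (le_max_right _ _).trans (le_max_right _ _)
  have hM0 : 0 ≤ M := L.coe_nonneg.trans hM2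
  refine ⟨(2 + (R + 1)) ^ p * M, ?_, fun e he => ?_⟩
  · exact DecayLip.of_support hp (by linarith) hsm.continuous (fun x => (hB x).trans hM1)
      (fun x y => (hLip x y).trans (by gcongr)) (fun x hx => hzero x (by linarith))
  · rw [mul_assoc]
    have hdiff := hsm.differentiable (by simp)
    refine DecayLip.of_support hp (by linarith) ?_ ?_ ?_ ?_
    · exact hsm.continuous.sub (hsm.continuous.comp (continuous_id.sub continuous_const))
    · intro x
      have := hLip x (x - e)
      rw [sub_sub_cancel] at this
      exact this.trans (by gcongr)
    · intro x y
      have hder : ∀ z, HasFDerivAt (fun x => ψ x - ψ (x - e))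
          (fderiv ℝ ψ z - fderiv ℝ ψ (z - e)) z := fun z =>
        (hdiff z).hasFDerivAt.sub
          (((hdiff (z - e)).hasFDerivAt).comp z ((hasFDerivAt_id z).sub_const e))
      have hb : ∀ z, ‖fderiv ℝ ψ z - fderiv ℝ ψ (z - e)‖ ≤ M * ‖e‖ := fun z => by
        have := hL'.norm_sub_le z (z - e)
        rw [sub_sub_cancel] at this
        exact this.trans (by gcongr)
      have := convex_univ.norm_image_sub_le_of_norm_hasFDerivWithin_le (𝕜 := ℝ)
        (fun z _ => (hder z).hasFDerivWithinAt) (fun z _ => hb z) (mem_univ y) (mem_univ x)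
      exact this
    · intro x hx
      rw [hzero x (by linarith), hzero (x - e) (by linarith [norm_sub_norm_le x e]), sub_zero]

/-! ### Truncated singular integrals and approximation by test functions -/

/-- The singular integral truncated at distance `ε`. -/
def truncLap {d : ℕ} (p ε : ℝ) (ψ : E d → ℝ) (x : E d) : ℝ :=
  ∫ y in {y : E d | ε < ‖x - y‖}, (ψ x - ψ y) / ‖x - y‖ ^ p

/-- The kernel truncated at distance `ε`. -/
def truncKern {d : ℕ} (p ε : ℝ) : E d → ℝ :=
  indicator {z : E d | ε < ‖z‖} fun z => ‖z‖ ^ (-p)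

lemma integrable_truncKern {d : ℕ} (hd : 0 < d) {r : ℝ} (hr : 0 < r) (hr' : 2 * r < 1)
    {ε : ℝ} (hε : 0 < ε) : Integrable (truncKern ((d : ℝ) + 2 * r) ε : E d → ℝ) := by
  have hS : MeasurableSet {z : E d | ε < ‖z‖} := measurableSet_lt measurable_const measurable_norm
  refine ((integrable_kern hd hr hr').const_mul (min 1 ε)⁻¹).mono'
    (Measurable.indicator (by fun_prop) hS).aestronglyMeasurable (ae_of_all _ fun z => ?_)
  have hm : 0 < min 1 ε := lt_min one_pos hε
  have hkn := kern_nonneg ((d : ℝ) + 2 * r) z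
  by_cases hz : ε < ‖z‖
  · rw [truncKern, indicator_of_mem (show z ∈ {z : E d | ε < ‖z‖} from hz),
      Real.norm_of_nonneg (by positivity), le_inv_mul_iff₀ hm, kern]
    gcongr
  · rw [truncKern, indicator_of_notMem (show z ∉ {z : E d | ε < ‖z‖} from hz), norm_zero]
    positivity

lemma truncLap_eq_integral_sub {d : ℕ} (p ε : ℝ) (ψ : E d → ℝ) (x : E d) :
    truncLap p ε ψ x = ∫ y, (ψ x - ψ y) * truncKern p ε (x - y) := by
  have hS : MeasurableSet {y : E d | ε < ‖x - y‖} := measurableSet_lt measurable_const (by fun_prop)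
  rw [truncLap, ← integral_indicator hS]
  refine integral_congr_ae (ae_of_all _ fun y => ?_)
  simp only [truncKern, indicator, mem_ofPred_eq]
  split_ifs
  · rw [div_eq_mul_inv, Real.rpow_neg (norm_nonneg _)]
  · simp

lemma truncLap_eq_integral {d : ℕ} (p ε : ℝ) (ψ : E d → ℝ) (x : E d) :
    truncLap p ε ψ x = ∫ z, (ψ x - ψ (x - z)) * truncKern p ε z := by
  rw [truncLap_eq_integral_sub,
    ← integral_sub_left_eq_self (fun z => (ψ x - ψ (x - z)) * truncKern p ε z) volume x]
  simp only [sub_sub_cancel]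

lemma IsTestFun.exists_bound {d : ℕ} {ψ : E d → ℝ} (hψ : IsTestFun ψ) : ∃ B, ∀ x, ‖ψ x‖ ≤ B :=
  hψ.2.exists_bound_of_continuous hψ.1.continuous

lemma integrable_mul_truncKern {d : ℕ} (hd : 0 < d) {r : ℝ} (hr : 0 < r) (hr' : 2 * r < 1)
    {ε : ℝ} (hε : 0 < ε) {ψ : E d → ℝ} (hψ : IsTestFun ψ) (x : E d) :
    Integrable fun z => (ψ x - ψ (x - z)) * truncKern ((d : ℝ) + 2 * r) ε z := by
  obtain ⟨B, hB⟩ := hψ.exists_bound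
  have hc := hψ.1.continuous
  refine (integrable_truncKern hd hr hr' hε).bdd_mul (c := B + B) (by fun_prop)
    (ae_of_all _ fun z => (norm_sub_le _ _).trans (add_le_add (hB _) (hB _)))

/-- The truncated kernel K is integrable, so the truncated operator is ψ∫K - ψ∗K, and the
convolution inherits the smoothness of ψ. -/
lemma contDiff_truncLap {d : ℕ} (hd : 0 < d) {r : ℝ} (hr : 0 < r) (hr' : 2 * r < 1)
    {ε : ℝ} (hε : 0 < ε) {ψ : E d → ℝ} (hψ : IsTestFun ψ) :
    ContDiff ℝ ∞ (truncLap ((d : ℝ) + 2 * r) ε ψ) := by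
  obtain ⟨B, hB⟩ := hψ.exists_bound
  have hK := integrable_truncKern hd hr hr' hε
  have hconv := hψ.2.contDiff_convolution_left (ContinuousLinearMap.mul ℝ ℝ) hψ.1
    hK.locallyIntegrable
  have heq : truncLap ((d : ℝ) + 2 * r) ε ψ = fun x =>
      ψ x * (∫ z : E d, truncKern ((d : ℝ) + 2 * r) ε z) -
        convolution ψ (truncKern ((d : ℝ) + 2 * r) ε) (ContinuousLinearMap.mul ℝ ℝ) volume x := by
    ext x
    have hKx := hK.comp_sub_left x
    simp only [truncLap_eq_integral_sub, convolution, ContinuousLinearMap.mul_apply', sub_mul]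
    rw [integral_sub (hKx.const_mul _) (hKx.bdd_mul hψ.1.continuous.aestronglyMeasurable
      (ae_of_all _ hB)), integral_const_mul,
      integral_sub_left_eq_self (fun z : E d => truncKern ((d : ℝ) + 2 * r) ε z) volume x]
  rw [heq]
  exact (hψ.1.mul contDiff_const).sub hconv

/-- Translation invariance turns the Lipschitz bound for the truncated integral into a size bound
for the truncated integral of an increment of ψ. -/
lemma truncLap_sub_truncLap {d : ℕ} (hd : 0 < d) {r : ℝ} (hr : 0 < r) (hr' : 2 * r < 1)
    {ε : ℝ} (hε : 0 < ε) {ψ : E d → ℝ} (hψ : IsTestFun ψ) (x e : E d) :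
    truncLap ((d : ℝ) + 2 * r) ε ψ x - truncLap ((d : ℝ) + 2 * r) ε ψ (x - e) =
      truncLap ((d : ℝ) + 2 * r) ε (fun z => ψ z - ψ (z - e)) x := by
  simp only [truncLap_eq_integral]
  rw [← integral_sub (integrable_mul_truncKern hd hr hr' hε hψ x)
    (integrable_mul_truncKern hd hr hr' hε hψ (x - e))]
  refine integral_congr_ae (ae_of_all _ fun z => ?_)
  simp only [sub_right_comm x e z]
  ring

/-- The truncated singular integrals of a test function are uniformly in the decay class. -/
lemma IsTestFun.exists_decayLip_truncLap {d : ℕ} (hd : 0 < d) {r : ℝ} (hr : 0 < r)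
    (hr' : 2 * r < 1) {ψ : E d → ℝ} (hψ : IsTestFun ψ) :
    ∃ A : ℝ, ∀ ε : ℝ, 0 < ε →
      DecayLip ((d : ℝ) + 2 * r) A (truncLap ((d : ℝ) + 2 * r) ε ψ) := by
  obtain ⟨A, hA, hA'⟩ := hψ.exists_decayLip (p := (d : ℝ) + 2 * r) (by positivity)
  refine ⟨decayConst d r * A, fun ε hε => ⟨(contDiff_truncLap hd hr hr' hε hψ).continuous,
    fun x => abs_setIntegral_diffQuot_le hd hr hr' hA x _, fun x y hxy => ?_⟩⟩
  have h := truncLap_sub_truncLap hd hr hr' hε hψ x (x - y)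
  rw [sub_sub_cancel] at h
  rw [h, mul_assoc (decayConst d r)]
  exact abs_setIntegral_diffQuot_le hd hr hr' (hA' (x - y) hxy) x _

lemma IsTestFun.comp_smul {d : ℕ} {ψ : E d → ℝ} (hψ : IsTestFun ψ) {c : ℝ} (hc : c ≠ 0) :
    IsTestFun fun x => ψ (c • x) :=
  ⟨hψ.1.comp (contDiff_const_smul c), hψ.2.comp_smul hc⟩

lemma IsTestFun.const_mul {d : ℕ} {ψ : E d → ℝ} (hψ : IsTestFun ψ) (c : ℝ) :
    IsTestFun fun x => c * ψ x :=
  ⟨contDiff_const.mul hψ.1, hψ.2.mul_left⟩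

/-- A smooth cutoff function which is `1` on the unit ball. -/
lemma exists_cutoff (d : ℕ) : ∃ χ : E d → ℝ, IsTestFun χ ∧ (∀ x, |χ x| ≤ 1) ∧
    ∀ x, ‖x‖ ≤ 1 → χ x = 1 := by
  let b : ContDiffBump (0 : E d) := ⟨1, 2, one_pos, one_lt_two⟩
  refine ⟨b, ⟨b.contDiff, b.hasCompactSupport⟩, fun x => ?_, fun x hx => ?_⟩
  · rw [abs_of_nonneg b.nonneg]; exact b.le_one
  · exact b.one_of_mem_closedBall (by simpa using hx)

lemma tendsto_cutoff {d : ℕ} {χ : E d → ℝ} (hχ : ∀ x, ‖x‖ ≤ 1 → χ x = 1) (x : E d) :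
    Tendsto (fun n : ℕ => χ (((n : ℝ) + 1)⁻¹ • x)) atTop (𝓝 1) := by
  refine tendsto_const_nhds.congr' ?_
  filter_upwards [eventually_ge_atTop ⌈‖x‖⌉₊] with n hn
  have h1 : ‖x‖ ≤ n := (Nat.le_ceil _).trans (by exact_mod_cast hn)
  have h2 : (0 : ℝ) < (n : ℝ) + 1 := by positivity
  refine (hχ _ ?_).symm
  rw [norm_smul, Real.norm_of_nonneg (by positivity), inv_mul_le_iff₀ h2]
  linarith

/-- The fractional Laplacian of a test function is the pointwise limit of test functions which
decay uniformly. -/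
lemma IsTestFun.exists_approx_fracLap {d : ℕ} (hd : 0 < d) {r : ℝ} (hr : 0 < r)
    (hr' : 2 * r < 1) {ψ : E d → ℝ} (hψ : IsTestFun ψ) :
    ∃ (A : ℝ) (f : ℕ → E d → ℝ), (∀ n, IsTestFun (f n)) ∧
      (∀ n, DecayLip ((d : ℝ) + 2 * r) A (f n)) ∧
      ∀ x, Tendsto (fun n => f n x) atTop (𝓝 (fracLap r ψ x)) := by
  obtain ⟨χ, hχ, hχ1, hχ2⟩ := exists_cutoff d
  obtain ⟨L, hL⟩ := hχ.1.lipschitzWith_of_hasCompactSupport hχ.2 (by simp)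
  obtain ⟨A, hA⟩ := hψ.exists_decayLip_truncLap hd hr hr'
  obtain ⟨A', hA', -⟩ := hψ.exists_decayLip (p := (d : ℝ) + 2 * r) (by positivity)
  have hε : ∀ n : ℕ, (0 : ℝ) < ((n : ℝ) + 1)⁻¹ := fun n => by positivity
  -- A single index n sets both the truncation radius 1/(n+1) and the scale n+1 of the cutoff.
  refine ⟨|fracConst d r| * ((1 + L) * A), fun n x => fracConst d r *
    (χ (((n : ℝ) + 1)⁻¹ • x) * truncLap ((d : ℝ) + 2 * r) ((n : ℝ) + 1)⁻¹ ψ x),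
    fun n => IsTestFun.const_mul ?_ _, fun n => DecayLip.const_mul ?_ _, fun x => ?_⟩
  · have := hχ.comp_smul (hε n).ne'
    exact ⟨this.1.mul (contDiff_truncLap hd hr hr' (hε n) hψ), this.2.mul_right⟩
  · refine (hA _ (hε n)).mul_left (LipschitzWith.of_dist_le_mul fun x y => ?_)
      fun x => hχ1 _
    refine (hL.dist_le_mul _ _).trans ?_
    gcongr
    -- A dilation by a factor at most 1 does not increase the Lipschitz constant, so L serves all n.
    rw [dist_smul₀, Real.norm_of_nonneg (hε n).le]
    refine mul_le_of_le_one_left dist_nonneg (inv_le_one_of_one_le₀ ?_)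
    linarith [Nat.cast_nonneg (α := ℝ) n]
  · rw [fracLap_eq hd hr hr' hA']
    have h0 : Tendsto (fun n : ℕ => ((n : ℝ) + 1)⁻¹) atTop (𝓝[>] 0) := by
      refine tendsto_nhdsWithin_iff.2 ⟨?_, Eventually.of_forall hε⟩
      simpa using tendsto_one_div_add_atTop_nhds_zero_nat (𝕜 := ℝ)
    have h1 := ((tendsto_truncated hd hr hr' hA' x).comp h0)
    have h2 := ((tendsto_cutoff hχ2 x).mul h1).const_mul (fracConst d r)
    rw [one_mul] at h2
    exact h2

/-! ### Scaling and the pairing with dilated cutoffs -/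

lemma fracLap_comp_smul {d : ℕ} (hd : 0 < d) {r : ℝ} (hr : 0 < r) (hr' : 2 * r < 1)
    {f : E d → ℝ} (hf : IsTestFun f) {c : ℝ} (hc : 0 < c) (x : E d) :
    fracLap r (fun y => f (c • y)) x = c ^ (2 * r) * fracLap r f (c • x) := by
  have hp : (0 : ℝ) ≤ (d : ℝ) + 2 * r := by positivity
  obtain ⟨A, hA, -⟩ := hf.exists_decayLip hp
  obtain ⟨B, hB, -⟩ := (hf.comp_smul hc.ne').exists_decayLip hp
  rw [fracLap_eq hd hr hr' hA, fracLap_eq hd hr hr' hB]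
  have h1 : ∀ y, (f (c • x) - f (c • y)) / ‖x - y‖ ^ ((d : ℝ) + 2 * r) =
      c ^ ((d : ℝ) + 2 * r) *
        ((f (c • x) - f (c • y)) / ‖c • x - c • y‖ ^ ((d : ℝ) + 2 * r)) := fun y => by
    have hcp : c ^ ((d : ℝ) + 2 * r) ≠ 0 := (Real.rpow_pos_of_pos hc _).ne'
    rw [← smul_sub, norm_smul, Real.norm_of_nonneg hc.le, Real.mul_rpow hc.le (norm_nonneg _),
      mul_div_assoc', mul_div_mul_left _ _ hcp]
  simp_rw [h1]
  rw [integral_const_mul, Measure.integral_comp_smul volume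
    (fun z => (f (c • x) - f z) / ‖c • x - z‖ ^ ((d : ℝ) + 2 * r)) c]
  have hdim : Module.finrank ℝ (E d) = d := by simp
  rw [hdim, abs_of_nonneg (by positivity), smul_eq_mul, Real.rpow_add hc, Real.rpow_natCast]
  field_simp

lemma fracLap_const_mul {d : ℕ} (hd : 0 < d) {r : ℝ} (hr : 0 < r) (hr' : 2 * r < 1)
    {f : E d → ℝ} (hf : IsTestFun f) (c : ℝ) (x : E d) :
    fracLap r (fun y => c * f y) x = c * fracLap r f x := by
  have hp : (0 : ℝ) ≤ (d : ℝ) + 2 * r := by positivity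
  obtain ⟨A, hA, -⟩ := hf.exists_decayLip hp
  rw [fracLap_eq hd hr hr' hA, fracLap_eq hd hr hr' (hA.const_mul c), mul_left_comm,
    ← integral_const_mul, ← integral_const_mul, ← integral_const_mul]
  refine integral_congr_ae (ae_of_all _ fun y => ?_)
  ring

/-- Since 1+c|x| ≥ c(1+|x|), giving up all decay beyond order γ costs only c^{-γ}; this is the loss
set against the scaling gain. -/
lemma decay_smul_le {d : ℕ} {p γ : ℝ} (hγ : 0 ≤ γ) (hγp : γ ≤ p) {c : ℝ} (hc : 0 < c)
    (hc1 : c ≤ 1) (x : E d) : decay p (c • x) ≤ c ^ (-γ) * decay γ x := by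
  have hx := norm_nonneg x
  have h1 : 1 + ‖c • x‖ = 1 + c * ‖x‖ := by rw [norm_smul, Real.norm_of_nonneg hc.le]
  rw [decay, decay, h1, ← Real.mul_rpow hc.le (by positivity)]
  calc (1 + c * ‖x‖) ^ (-p) ≤ (1 + c * ‖x‖) ^ (-γ) :=
        Real.rpow_le_rpow_of_exponent_le (by nlinarith) (by linarith)
    _ ≤ _ := Real.rpow_le_rpow_of_nonpos (by positivity) (by nlinarith) (by linarith)

/-- Testing `(-Δ)^r v` against the fractional Laplacian of a dilated test function: the pairing is
small for large dilations whenever `v` is integrable against a slowly decaying profile. -/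
lemma IsTestFun.exists_abs_integral_mul_fracLap_le {d : ℕ} (hd : 0 < d) {r : ℝ} (hr : 0 < r)
    (hr' : 2 * r < 1) {ψ : E d → ℝ} (hψ : IsTestFun ψ) :
    ∃ C : ℝ, 0 ≤ C ∧ ∀ (v g : E d → ℝ) (γ c : ℝ), IsDistribFracLap r v g → 0 ≤ γ →
      γ ≤ (d : ℝ) + 2 * r → Integrable (fun x => |v x| * decay γ x) → 0 < c → c ≤ 1 →
      |∫ x, g x * fracLap r (fun y => ψ (c • y)) x| ≤
        C * c ^ (4 * r - γ) * ∫ x, |v x| * decay γ x := by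
  obtain ⟨A, f, hft, hfd, hlim⟩ := hψ.exists_approx_fracLap hd hr hr'
  have hA0 : 0 ≤ A := (hfd 0).const_nonneg
  have hC0 : 0 ≤ |fracConst d r| * (decayConst d r * A) :=
    mul_nonneg (abs_nonneg _) (mul_nonneg (decayConst_nonneg d r) hA0)
  refine ⟨|fracConst d r| * (decayConst d r * A), hC0, ?_⟩
  rintro v g γ c ⟨hg, hvg⟩ hγ hγp hv hc hc1
  set p : ℝ := (d : ℝ) + 2 * r with hp
  have hcr : (0 : ℝ) < c ^ (2 * r) := Real.rpow_pos_of_pos hc _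
  have hF : ∀ n, IsTestFun fun x => c ^ (2 * r) * f n (c • x) := fun n =>
    ((hft n).comp_smul hc.ne').const_mul _
  have hdec : MemLp (fun x : E d => decay p (c • x)) 2 := by
    have hcont : Continuous fun x : E d => decay p (c • x) :=
      (continuous_decay p).comp (continuous_const_smul c)
    rw [memLp_two_iff_integrable_sq hcont.aestronglyMeasurable]
    exact (integrable_decay_sq (d := d) (p := p) (by linarith)).comp_smul hc.ne'
  have hbd : Integrable fun x => c ^ (2 * r) * A * (‖g x‖ * decay p (c • x)) :=
    (hg.norm.integrable_mul hdec).const_mul _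
  -- The limit is taken only on the side of g, dominated by a product of two L² functions. On the
  -- side of v a bound uniform in n is enough.
  have hconv : Tendsto (fun n => ∫ x, g x * (c ^ (2 * r) * f n (c • x))) atTop
      (𝓝 (∫ x, g x * fracLap r (fun y => ψ (c • y)) x)) := by
    refine tendsto_integral_of_dominated_convergence _ (fun n =>
      hg.aestronglyMeasurable.mul (hF n).1.continuous.aestronglyMeasurable) hbd
      (fun n => ae_of_all _ fun x => ?_) (ae_of_all _ fun x => ?_)
    · rw [norm_mul, norm_mul, Real.norm_of_nonneg hcr.le]
      calc ‖g x‖ * (c ^ (2 * r) * ‖f n (c • x)‖)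
          ≤ ‖g x‖ * (c ^ (2 * r) * (A * decay p (c • x))) := by
            gcongr; exact (hfd n).bound _
        _ = _ := by ring
    · rw [fracLap_comp_smul hd hr hr' hψ hc]
      exact ((hlim _).const_mul _).const_mul _
  refine le_of_tendsto hconv.abs (Eventually.of_forall fun n => ?_)
  rw [← (hvg _ (hF n)).2, ← Real.norm_eq_abs, ← integral_const_mul]
  refine norm_integral_le_of_norm_le (hv.const_mul _) (ae_of_all _ fun x => ?_)
  rw [fracLap_const_mul hd hr hr' ((hft n).comp_smul hc.ne'), fracLap_comp_smul hd hr hr' (hft n) hc,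
    norm_mul, norm_mul, norm_mul, Real.norm_of_nonneg hcr.le, Real.norm_eq_abs, Real.norm_eq_abs]
  -- One factor c^{2r} for each of the two operators, and c^{-γ} from `decay_smul_le`.
  have h4 : c ^ (4 * r - γ) = c ^ (2 * r) * c ^ (2 * r) * c ^ (-γ) := by
    rw [← Real.rpow_add hc, ← Real.rpow_add hc]; congr 1; ring
  calc |v x| * (c ^ (2 * r) * (c ^ (2 * r) * |fracLap r (f n) (c • x)|))
      ≤ |v x| * (c ^ (2 * r) * (c ^ (2 * r) * (|fracConst d r| * (decayConst d r * A) *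
          (c ^ (-γ) * decay γ x)))) := by
        gcongr
        refine (abs_fracLap_le hd hr hr' (hfd n) _).trans ?_
        exact mul_le_mul_of_nonneg_left (decay_smul_le hγ hγp hc hc1 x) hC0
    _ = _ := by rw [h4]; ring

/-! ### Vanishing distributional derivative on the half line -/

/-- A smooth function with compact support in the half line and vanishing integral is the derivative
of such a function. -/
lemma exists_primitive_of_integral_eq_zero {θ : ℝ → ℝ} (hθ : ContDiff ℝ ∞ θ)
    (hc : HasCompactSupport θ) (hsupp : tsupport θ ⊆ Ioi 0) (h0 : ∫ t, θ t = 0) :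
    ∃ η : ℝ → ℝ, ContDiff ℝ ∞ η ∧ HasCompactSupport η ∧ tsupport η ⊆ Ioi 0 ∧ deriv η = θ := by
  obtain ⟨a, ha0, b, hab⟩ : ∃ a : ℝ, 0 < a ∧ ∃ b : ℝ, ∀ t, θ t ≠ 0 → t ∈ Ioc a b := by
    rcases (tsupport θ).eq_empty_or_nonempty with he | hne
    · refine ⟨1, one_pos, 1, fun t ht => ?_⟩
      exact absurd (subset_tsupport θ ht) (by simp [he])
    · obtain ⟨a, ha, ha'⟩ := hc.isCompact.exists_isLeast hne
      obtain ⟨b, hb, hb'⟩ := hc.isCompact.exists_isGreatest hne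
      have ha0 : 0 < a := hsupp ha
      refine ⟨a / 2, by linarith, b, fun t ht => ⟨?_, hb' (subset_tsupport θ ht)⟩⟩
      linarith [ha' (subset_tsupport θ ht)]
  have hder : deriv (fun t => ∫ x in a..t, θ x) = θ := by
    ext t
    exact hθ.continuous.deriv_integral θ a t
  have hzero : ∀ t, t ∉ Icc a b → ∫ x in a..t, θ x = 0 := by
    intro t ht
    rcases le_or_gt a t with hat | hat
    · have hbt : b < t := by
        by_contra hcon
        exact ht ⟨hat, not_lt.1 hcon⟩
      -- Past b the primitive is the full integral of θ, hence zero.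
      rw [intervalIntegral.integral_eq_integral_of_support_subset, h0]
      intro x hx
      exact ⟨(hab x hx).1, (hab x hx).2.trans hbt.le⟩
    · rw [intervalIntegral.integral_congr (g := fun _ => (0 : ℝ)), intervalIntegral.integral_zero]
      intro x hx
      rw [uIcc_of_ge hat.le] at hx
      by_contra hcon
      exact absurd (hab x hcon).1 (not_lt.2 hx.2)
  have hts : tsupport (fun t => ∫ x in a..t, θ x) ⊆ Icc a b :=
    closure_minimal (fun t ht => by_contra fun hcon => ht (hzero t hcon)) isClosed_Icc
  refine ⟨fun t => ∫ x in a..t, θ x, contDiff_infty_iff_deriv.2 ⟨fun t => ?_, by rwa [hder]⟩,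
    HasCompactSupport.of_support_subset_isCompact isCompact_Icc
      ((subset_tsupport _).trans hts), fun t ht => ha0.trans_le (hts ht).1, hder⟩
  exact (hθ.continuous.integral_hasStrictDerivAt a t).hasDerivAt.differentiableAt

/-- A function on the half line whose distributional derivative vanishes is constant. -/
lemma exists_ae_eq_const_of_integral_deriv_mul_eq_zero {F : ℝ → ℝ}
    (hF : LocallyIntegrable F (volume.restrict (Ioi 0)))
    (h : ∀ η : ℝ → ℝ, ContDiff ℝ ∞ η → HasCompactSupport η → tsupport η ⊆ Ioi 0 →
      ∫ t in Ioi (0 : ℝ), deriv η t * F t = 0) :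
    ∃ c : ℝ, ∀ᵐ t, t ∈ Ioi (0 : ℝ) → F t = c := by
  obtain ⟨ζ₀, hζ₀, hζ₀c, hζ₀s, hζ₀i⟩ : ∃ ζ₀ : ℝ → ℝ, ContDiff ℝ ∞ ζ₀ ∧ HasCompactSupport ζ₀ ∧
      tsupport ζ₀ ⊆ Ioi 0 ∧ ∫ t, ζ₀ t = 1 := by
    let b : ContDiffBump (2 : ℝ) := ⟨1 / 2, 1, by norm_num, by norm_num⟩
    refine ⟨b.normed volume, b.contDiff_normed, b.hasCompactSupport_normed, ?_,
      b.integral_normed⟩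
    rw [b.tsupport_normed_eq]
    intro t ht
    have h1 : |t - 2| ≤ 1 := by simpa [Real.dist_eq] using ht
    have h2 := (abs_le.1 h1).1
    show 0 < t
    linarith
  set c : ℝ := ∫ t in Ioi (0 : ℝ), ζ₀ t * F t with hcdef
  have hFU : LocallyIntegrableOn (fun t => F t - c) (Ioi 0) := by
    have hconst : LocallyIntegrableOn (fun _ : ℝ => c) (Ioi 0) :=
      (locallyIntegrable_const c).locallyIntegrableOn _
    exact (locallyIntegrableOn_of_locallyIntegrable_restrict hF).sub hconst
  refine ⟨c, ?_⟩
  have key := isOpen_Ioi.ae_eq_zero_of_integral_contDiff_smul_eq_zero hFU ?_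
  · filter_upwards [key] with t ht h0
    exact sub_eq_zero.1 (ht h0)
  intro ζ hζ hζc hζs
  have hi : ∀ {ξ : ℝ → ℝ}, ContDiff ℝ ∞ ξ → HasCompactSupport ξ →
      Integrable (fun t => ξ t * F t) (volume.restrict (Ioi 0)) := fun h1 h2 =>
    hF.integrable_smul_left_of_hasCompactSupport h1.continuous h2
  have hζi : Integrable ζ := hζ.continuous.integrable_of_hasCompactSupport hζc
  have hζ₀int : Integrable ζ₀ := hζ₀.continuous.integrable_of_hasCompactSupport hζ₀c
  have hrestr : ∫ t, ζ t • (F t - c) = ∫ t in Ioi (0 : ℝ), (ζ t * F t - ζ t * c) := by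
    rw [setIntegral_eq_integral_of_forall_compl_eq_zero]
    · exact integral_congr_ae (ae_of_all _ fun t => mul_sub _ _ _)
    · intro t ht
      rw [image_eq_zero_of_notMem_tsupport fun hcon => ht (hζs hcon)]
      simp
  have hζint : ∫ t in Ioi (0 : ℝ), ζ t = ∫ t, ζ t :=
    setIntegral_eq_integral_of_forall_compl_eq_zero fun t ht =>
      image_eq_zero_of_notMem_tsupport fun hcon => ht (hζs hcon)
  -- Subtracting (∫ζ)ζ₀ removes the mean, so the difference is an admissible derivative; the
  -- hypothesis then gives ∫ζF = c∫ζ.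
  have hθ : ContDiff ℝ ∞ fun t => ζ t - (∫ t, ζ t) * ζ₀ t := hζ.sub (contDiff_const.mul hζ₀)
  obtain ⟨η, hη, hηc, hηs, hηd⟩ := exists_primitive_of_integral_eq_zero hθ
    (hζc.sub hζ₀c.mul_left) ((tsupport_sub ζ (fun t => (∫ t, ζ t) * ζ₀ t)).trans
      (union_subset hζs ((tsupport_mul_subset_right).trans hζ₀s))) (by
      rw [integral_sub hζi (hζ₀int.const_mul _), integral_const_mul, hζ₀i, mul_one, sub_self])
  have h0 := h η hη hηc hηs
  rw [hηd] at h0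
  simp only [sub_mul, mul_assoc] at h0
  rw [integral_sub (hi hζ hζc) ((hi hζ₀ hζ₀c).const_mul _), integral_const_mul] at h0
  rw [hrestr, integral_sub (hi hζ hζc) (hζi.integrableOn.mul_const c), integral_mul_const, hζint]
  exact h0

/-! ### Time slices, the weight and product test functions -/

lemma restrict_univ_prod_Ioi {d : ℕ} (τ : ℝ) :
    (volume : Measure (E d × ℝ)).restrict (univ ×ˢ Ioi τ) =
      (volume : Measure (E d)).prod (volume.restrict (Ioi τ)) := by
  rw [Measure.volume_eq_prod, ← Measure.prod_restrict, Measure.restrict_univ]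

lemma ae_ae_of_ae_restrict {d : ℕ} {τ : ℝ} {P : E d → ℝ → Prop}
    (h : ∀ᵐ p ∂(volume.restrict ((univ : Set (E d)) ×ˢ Ioi τ)), P p.1 p.2) :
    ∀ᵐ t ∂(volume.restrict (Ioi τ)), ∀ᵐ x : E d, P x t := by
  rw [restrict_univ_prod_Ioi] at h
  exact Measure.ae_ae_of_ae_prod (Measure.measurePreserving_swap.quasiMeasurePreserving.ae h)

/-- The weight dominates a multiple of its slowest decaying profile. -/
lemma IsWeight.exists_mul_decay_le {d : ℕ} (hd : 0 < d) {γ γ₀ : ℝ} (hγ : 0 ≤ γ) (hγ₀ : 0 ≤ γ₀)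
    {ρ : E d → ℝ} (hρ : IsWeight γ γ₀ ρ) :
    ∃ c : ℝ, 0 < c ∧ ∀ᵐ x, c * decay γ x ≤ ρ x := by
  have : Nonempty (Fin d) := ⟨⟨0, hd⟩⟩
  obtain ⟨c, C, hc, -, hin, hout⟩ := hρ.bounds
  -- The origin is discarded because `0 ^ (-γ₀)` is `0` in Lean when γ₀ ≠ 0, which makes the lower
  -- bound on ρ void there.
  have h0 : ∀ᵐ x : E d, x ≠ 0 := compl_mem_ae_iff.2 (measure_singleton 0)
  refine ⟨c, hc, ?_⟩
  filter_upwards [hin, hout, h0] with x h1 h2 hx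
  have hx0 : 0 < ‖x‖ := norm_pos_iff.2 hx
  rcases lt_or_ge ‖x‖ 1 with h | h
  · refine le_trans ?_ (h1 h).1
    gcongr
    exact (decay_le_one hγ x).trans
      (Real.one_le_rpow_of_pos_of_le_one_of_nonpos hx0 h.le (by linarith))
  · refine le_trans ?_ (h2 h).1
    gcongr
    exact Real.rpow_le_rpow_of_nonpos hx0 (by linarith) (by linarith)

/-- Boundedness gives w^m ≤ M^{m-1}w, and the profile is at most ρ/c: the nonlinearity is controlled
by the mass. -/
lemma integrable_rpow_mul_decay {d : ℕ} {γ m M c : ℝ} (hm : 1 < m) (hc : 0 < c)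
    {ρ w : E d → ℝ} (hρ : ∀ᵐ x, c * decay γ x ≤ ρ x) (hw0 : ∀ᵐ x, 0 ≤ w x)
    (hwM : ∀ᵐ x, |w x| ≤ M) (hwm : AEStronglyMeasurable (fun x => w x ^ m))
    (hint : Integrable fun x => w x * ρ x) :
    Integrable (fun x => |w x ^ m| * decay γ x) ∧
      ∫ x, |w x ^ m| * decay γ x ≤ M ^ (m - 1) / c * ∫ x, w x * ρ x := by
  have hle : ∀ᵐ x, |w x ^ m| * decay γ x ≤ M ^ (m - 1) / c * (w x * ρ x) := by
    filter_upwards [hρ, hw0, hwM] with x h1 h2 h3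
    have h3' : w x ≤ M := (le_abs_self _).trans h3
    have hM0 : 0 ≤ M := h2.trans h3'
    have hpow : w x ^ m = w x ^ (m - 1) * w x := by
      conv_lhs => rw [← sub_add_cancel m 1]
      rw [Real.rpow_add_one' h2 (by linarith)]
    have hdec : decay γ x ≤ ρ x / c := by rwa [le_div_iff₀ hc, mul_comm]
    have hd0 := (decay_pos γ x).le
    rw [abs_of_nonneg (Real.rpow_nonneg h2 m), hpow]
    calc w x ^ (m - 1) * w x * decay γ x ≤ M ^ (m - 1) * w x * (ρ x / c) := by
          gcongr
      _ = _ := by ring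
  have hnn : ∀ x, 0 ≤ |w x ^ m| * decay γ x := fun x =>
    mul_nonneg (abs_nonneg _) (decay_pos γ x).le
  have hI : Integrable (fun x => |w x ^ m| * decay γ x) := by
    refine (hint.const_mul (M ^ (m - 1) / c)).mono'
      (hwm.norm.mul (continuous_decay γ).aestronglyMeasurable) ?_
    filter_upwards [hle] with x hx
    rwa [Real.norm_of_nonneg (hnn x)]
  refine ⟨hI, ?_⟩
  rw [← integral_const_mul]
  exact integral_mono_ae hI (hint.const_mul _) hle

lemma exists_pos_lt_of_tsupport_subset_Ioi {η : ℝ → ℝ} (hc : HasCompactSupport η)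
    (hs : tsupport η ⊆ Ioi 0) : ∃ τ : ℝ, 0 < τ ∧ ∀ t, t ≤ τ → η t = 0 := by
  rcases (tsupport η).eq_empty_or_nonempty with he | hne
  · exact ⟨1, one_pos, fun t _ => image_eq_zero_of_notMem_tsupport (by simp [he])⟩
  · obtain ⟨a, ha, ha'⟩ := hc.isCompact.exists_isLeast hne
    have ha0 : 0 < a := hs ha
    refine ⟨a / 2, by linarith, fun t ht => image_eq_zero_of_notMem_tsupport fun hcon => ?_⟩
    linarith [ha' hcon]

lemma IsTestFun.isSpaceTimeTestFun {d : ℕ} {ψ : E d → ℝ} (hψ : IsTestFun ψ) {η : ℝ → ℝ}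
    (hη : ContDiff ℝ ∞ η) (hηc : HasCompactSupport η) (hηs : tsupport η ⊆ Ioi 0) :
    IsSpaceTimeTestFun fun x t => η t * ψ x := by
  have hsub : Function.support (Function.uncurry fun x t => η t * ψ x) ⊆
      tsupport ψ ×ˢ tsupport η := fun q hq =>
    ⟨subset_tsupport _ (right_ne_zero_of_mul hq), subset_tsupport _ (left_ne_zero_of_mul hq)⟩
  refine ⟨(hη.comp contDiff_snd).mul (hψ.1.comp contDiff_fst),
    HasCompactSupport.of_support_subset_isCompact (hψ.2.isCompact.prod hηc.isCompact) hsub, ?_⟩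
  exact (closure_minimal hsub ((isClosed_tsupport _).prod (isClosed_tsupport _))).trans
    (prod_mono (subset_univ _) hηs)

lemma abs_integral_cutoff_le {d : ℕ} {χ w : E d → ℝ} (hχ : ∀ x, |χ x| ≤ 1)
    (hw : Integrable w) (hw0 : ∀ᵐ x, 0 ≤ w x) : |∫ x, χ x * w x| ≤ ∫ x, w x := by
  rw [← Real.norm_eq_abs]
  refine norm_integral_le_of_norm_le hw ?_
  filter_upwards [hw0] with x hx
  rw [norm_mul, Real.norm_of_nonneg hx]
  exact mul_le_of_le_one_left hx (hχ x)

/-! ### Conservation of mass in the distributional sense -/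

namespace IsWeakSolution

variable {d : ℕ} {s m γ γ₀ : ℝ} {ρ : E d → ℝ} {μ : Measure (E d)} {u : E d → ℝ → ℝ}

lemma aestronglyMeasurable_weighted (hu : IsWeakSolution s m ρ μ u) (hρ : IsWeight γ γ₀ ρ)
    {χ : E d → ℝ} (hχ : Continuous χ) :
    AEStronglyMeasurable (fun t => ∫ x, χ x * (u x t * ρ x)) (volume.restrict (Ioi 0)) := by
  have h1 := hu.measurable
  rw [restrict_univ_prod_Ioi] at h1
  have h2 : AEStronglyMeasurable (fun q : E d × ℝ => χ q.1 * (u q.1 q.2 * ρ q.1))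
      ((volume : Measure (E d)).prod (volume.restrict (Ioi 0))) :=
    (hχ.comp continuous_fst).aestronglyMeasurable.mul
      (h1.mul (hρ.aemeasurable.aestronglyMeasurable.comp_quasiMeasurePreserving
        Measure.quasiMeasurePreserving_fst))
  exact h2.prod_swap.integral_prod_right'

lemma ae_nonneg (hu : IsWeakSolution s m ρ μ u) :
    ∀ᵐ t ∂(volume.restrict (Ioi (0 : ℝ))), ∀ᵐ x, 0 ≤ u x t :=
  ae_ae_of_ae_restrict hu.nonneg

lemma exists_mass_le (hu : IsWeakSolution s m ρ μ u) (hρ0 : ∀ᵐ x, 0 ≤ ρ x) :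
    ∃ M : ℝ, 0 ≤ M ∧ ∀ᵐ t ∂(volume.restrict (Ioi (0 : ℝ))),
      Integrable (fun x => u x t * ρ x) ∧ (∀ᵐ x, 0 ≤ u x t * ρ x) ∧
        (∫ x, |u x t| * ρ x) = (∫ x, u x t * ρ x) ∧ ∫ x, u x t * ρ x ≤ M := by
  obtain ⟨M, hM⟩ := hu.bounded_L1
  refine ⟨max M 0, le_max_right _ _, ?_⟩
  filter_upwards [hM, hu.ae_nonneg] with t ht h0
  have heq : (∫ x, |u x t| * ρ x) = ∫ x, u x t * ρ x := by
    refine integral_congr_ae ?_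
    filter_upwards [h0] with x hx
    rw [abs_of_nonneg hx]
  refine ⟨ht.1, ?_, heq, heq ▸ ht.2.trans (le_max_left _ _)⟩
  filter_upwards [h0, hρ0] with x h1 h2 using mul_nonneg h1 h2

/-- The mass has vanishing distributional derivative in time. -/
lemma integral_deriv_mul_mass_eq_zero (hu : IsWeakSolution s m ρ μ u) (hd : 0 < d) (hs : 0 < s)
    (hs' : s < 1) (hm : 1 < m) (hγ : 0 ≤ γ) (hγs : γ < 2 * s) (hγd : γ ≤ (d : ℝ) + s)
    (hγ₀ : 0 ≤ γ₀) (hρ : IsWeight γ γ₀ ρ) {η : ℝ → ℝ} (hη : ContDiff ℝ ∞ η)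
    (hηc : HasCompactSupport η) (hηs : tsupport η ⊆ Ioi 0) :
    ∫ t in Ioi (0 : ℝ), deriv η t * ∫ x, u x t * ρ x = 0 := by
  obtain ⟨c, hc, hcρ⟩ := hρ.exists_mul_decay_le hd hγ hγ₀
  have hρ0 : ∀ᵐ x, 0 ≤ ρ x := by
    filter_upwards [hcρ] with x hx using (mul_pos hc (decay_pos γ x)).le.trans hx
  obtain ⟨M, hM0, hM⟩ := hu.exists_mass_le hρ0
  obtain ⟨τ, hτ, hητ⟩ := exists_pos_lt_of_tsupport_subset_Ioi hηc hηs
  obtain ⟨N, hN⟩ := hu.bounded τ hτ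
  obtain ⟨χ, hχ, hχ1, hχ2⟩ := exists_cutoff d
  obtain ⟨C, hC0, hC⟩ := hχ.exists_abs_integral_mul_fracLap_le hd (half_pos hs)
    (by linarith : 2 * (s / 2) < 1)
  obtain ⟨g, -, hg, hweak⟩ := hu.weak_eq
  set ε : ℕ → ℝ := fun n => ((n : ℝ) + 1)⁻¹ with hεdef
  have hε : ∀ n, 0 < ε n := fun n => by positivity
  have hε1 : ∀ n, ε n ≤ 1 := fun n =>
    inv_le_one_of_one_le₀ (by linarith [Nat.cast_nonneg (α := ℝ) n])
  have hε0 : Tendsto ε atTop (𝓝 0) := by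
    simpa [hεdef] using tendsto_one_div_add_atTop_nhds_zero_nat (𝕜 := ℝ)
  have hχn : ∀ n, IsTestFun fun x => χ (ε n • x) := fun n => hχ.comp_smul (hε n).ne'
  have hη' : Continuous (deriv η) := hη.continuous_deriv (by simp)
  have hη'c : HasCompactSupport (deriv η) := hηc.deriv
  -- the weak formulation for the product test functions
  have hid : ∀ n, ∫ t in Ioi (0 : ℝ), deriv η t * ∫ x, χ (ε n • x) * (u x t * ρ x) =
      ∫ t in Ioi (0 : ℝ), η t * ∫ x, g x t * fracLap (s / 2) (fun y => χ (ε n • y)) x := by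
    intro n
    have h := hweak _ ((hχn n).isSpaceTimeTestFun hη hηc hηs)
    have hl : ∀ t, ∫ x, u x t * deriv (fun τ => η τ * χ (ε n • x)) t * ρ x =
        deriv η t * ∫ x, χ (ε n • x) * (u x t * ρ x) := fun t => by
      rw [← integral_const_mul]
      refine integral_congr_ae (ae_of_all _ fun x => ?_)
      simp only [deriv_mul_const_field]
      ring
    have hr : ∀ t, ∫ x, g x t * fracLap (s / 2) (fun y => η t * χ (ε n • y)) x =
        η t * ∫ x, g x t * fracLap (s / 2) (fun y => χ (ε n • y)) x := fun t => by
      rw [← integral_const_mul]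
      refine integral_congr_ae (ae_of_all _ fun x => ?_)
      simp only [fracLap_const_mul hd (half_pos hs) (by linarith : 2 * (s / 2) < 1) (hχn n)]
      ring
    simp only [hl, hr] at h
    linarith
  -- the diffusion term vanishes in the limit
  have hdiff : Tendsto (fun n => ∫ t in Ioi (0 : ℝ),
      η t * ∫ x, g x t * fracLap (s / 2) (fun y => χ (ε n • y)) x) atTop (𝓝 0) := by
    -- The absolute value is there because no sign of N is known.
    set K : ℝ := |N ^ (m - 1) / c| * M with hK
    have hK0 : 0 ≤ K := by positivity
    have hbound : ∀ n, |∫ t in Ioi (0 : ℝ),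
        η t * ∫ x, g x t * fracLap (s / 2) (fun y => χ (ε n • y)) x| ≤
        ε n ^ (2 * s - γ) * ∫ t in Ioi (0 : ℝ), C * K * |η t| := by
      intro n
      rw [← Real.norm_eq_abs, ← integral_const_mul]
      have hηi : Integrable (fun t => |η t|) (volume.restrict (Ioi 0)) :=
        (hη.continuous.integrable_of_hasCompactSupport hηc).abs.integrableOn
      refine norm_integral_le_of_norm_le ((hηi.const_mul _).const_mul _) ?_
      have hNt := ae_ae_of_ae_restrict (P := fun x t => |u x t| ≤ N) hN
      -- The sup bound N is available only after time τ; up to τ the factor η vanishes.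
      have hNt' : ∀ᵐ t ∂(volume.restrict (Ioi (0 : ℝ))), τ < t → ∀ᵐ x, |u x t| ≤ N := by
        rw [ae_restrict_iff' measurableSet_Ioi] at hNt
        exact ae_restrict_of_ae hNt
      filter_upwards [hNt', hg, hM, hu.ae_nonneg, hu.energy.2.1] with t h1 h2 h3 h4 h5
      rcases le_or_gt t τ with htτ | htτ
      · simp [hητ t htτ]
      obtain ⟨hI, hIle⟩ := integrable_rpow_mul_decay hm hc hcρ h4 (h1 htτ) h5.1 h3.1
      have hmain := hC _ _ γ (ε n) h2 hγ (by linarith) hI (hε n) (hε1 n)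
      have hmass0 : 0 ≤ ∫ x, u x t * ρ x := integral_nonneg_of_ae h3.2.1
      have hIK : ∫ x, |u x t ^ m| * decay γ x ≤ K := by
        refine hIle.trans ?_
        calc _ ≤ |N ^ (m - 1) / c| * ∫ x, u x t * ρ x := by gcongr; exact le_abs_self _
          _ ≤ K := by rw [hK]; gcongr; exact h3.2.2.2
      have hεn := Real.rpow_nonneg (hε n).le (2 * s - γ)
      rw [show 4 * (s / 2) - γ = 2 * s - γ by ring] at hmain
      rw [norm_mul, Real.norm_eq_abs, Real.norm_eq_abs]
      calc |η t| * _ ≤ |η t| * (C * ε n ^ (2 * s - γ) * K) := by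
            gcongr
            exact hmain.trans (by gcongr)
        _ = _ := by ring
    have hlim : Tendsto (fun n => ε n ^ (2 * s - γ) * ∫ t in Ioi (0 : ℝ), C * K * |η t|) atTop
        (𝓝 0) := by
      have h1 := hε0.rpow_const (p := 2 * s - γ) (Or.inr (by linarith))
      rw [Real.zero_rpow (by linarith)] at h1
      simpa using h1.mul_const (∫ t in Ioi (0 : ℝ), C * K * |η t|)
    exact squeeze_zero_norm hbound hlim
  -- the mass term converges
  have hmass : Tendsto (fun n => ∫ t in Ioi (0 : ℝ),
      deriv η t * ∫ x, χ (ε n • x) * (u x t * ρ x)) atTop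
      (𝓝 (∫ t in Ioi (0 : ℝ), deriv η t * ∫ x, u x t * ρ x)) := by
    have hη'i : Integrable (fun t => ‖deriv η t‖ * M) (volume.restrict (Ioi 0)) :=
      ((hη'.integrable_of_hasCompactSupport hη'c).norm.mul_const M).integrableOn
    -- Two nested dominated convergences: in time under M|η'|, and in space under |uρ| on each
    -- slice.
    refine tendsto_integral_of_dominated_convergence _ (fun n =>
      hη'.aestronglyMeasurable.mul
        (hu.aestronglyMeasurable_weighted hρ (hχn n).1.continuous)) hη'i (fun n => ?_) ?_
    · filter_upwards [hM] with t ht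
      rw [norm_mul]
      gcongr
      exact (abs_integral_cutoff_le (fun x => hχ1 _) ht.1 ht.2.1).trans ht.2.2.2
    · filter_upwards [hM] with t ht
      refine Tendsto.const_mul _ ?_
      refine tendsto_integral_of_dominated_convergence _ (fun n =>
        (hχn n).1.continuous.aestronglyMeasurable.mul ht.1.aestronglyMeasurable) ht.1.norm
        (fun n => ae_of_all _ fun x => ?_) (ae_of_all _ fun x => ?_)
      · rw [norm_mul]
        exact mul_le_of_le_one_left (norm_nonneg _) (hχ1 _)
      · simpa using (tendsto_cutoff hχ2 x).mul_const (u x t * ρ x)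
  exact tendsto_nhds_unique hmass (by simpa only [hid] using hdiff)

end IsWeakSolution

/-! ### Identification of the constant mass -/

/-- Intervals (0, b) have positive measure, so they meet every conull set. Without this an essential
limit at 0 would not be unique. -/
lemma neBot_ae_inf_nhdsGT_zero : (ae (volume : Measure ℝ) ⊓ 𝓝[>] 0).NeBot := by
  refine inf_neBot_iff.2 fun {A} hA {B} hB => ?_
  obtain ⟨b, hb, hbB⟩ := mem_nhdsGT_iff_exists_Ioo_subset.1 hB
  have hb0 : (0 : ℝ) < b := hb
  have hpos : volume (Ioo (0 : ℝ) b) ≠ 0 := by simp [hb0]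
  by_contra hcon
  rw [not_nonempty_iff_eq_empty, ← disjoint_iff_inter_eq_empty] at hcon
  refine hpos (measure_mono_null (fun t ht => ?_) (mem_ae_iff.1 hA))
  exact fun htA => disjoint_left.1 hcon htA (hbB ht)

end

end FracPME

theorem proposition4p1 (d : ℕ) (s m γ γ₀ : ℝ) (hs : 0 < s) (hs' : s < 1)
    (hd : 2 * s < (d : ℝ)) (hm : 1 < m)
    (hγ : 0 ≤ γ) (hγs : γ < 2 * s) (hγd : γ ≤ (d : ℝ) - 2 * s)
    (hγ₀ : 0 ≤ γ₀) (hγ₀γ : γ₀ ≤ γ)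
    (ρ : FracPME.E d → ℝ) (hρ : FracPME.IsWeight γ γ₀ ρ)
    (μ : MeasureTheory.Measure (FracPME.E d)) [MeasureTheory.IsFiniteMeasure μ]
    (u : FracPME.E d → ℝ → ℝ) (hu : FracPME.IsWeakSolution s m ρ μ u) :
    ∀ᵐ t ∂(MeasureTheory.volume.restrict (Set.Ioi (0 : ℝ))),
      MeasureTheory.Integrable (fun x => u x t * ρ x) MeasureTheory.volume ∧
        ∫ x, |u x t| * ρ x = ∫ x, u x t * ρ x ∧
        ∫ x, u x t * ρ x = μ.real Set.univ := by
  have hd0 : 0 < d := by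
    have : (0 : ℝ) < d := by linarith
    exact_mod_cast this
  obtain ⟨c, hc, hcρ⟩ := hρ.exists_mul_decay_le hd0 hγ hγ₀
  have hρ0 : ∀ᵐ x, 0 ≤ ρ x := by
    filter_upwards [hcρ] with x hx using (mul_pos hc (FracPME.decay_pos γ x)).le.trans hx
  obtain ⟨M, -, hM⟩ := hu.exists_mass_le hρ0
  have hmeas : AEStronglyMeasurable (fun t => ∫ x, u x t * ρ x) (volume.restrict (Ioi 0)) := by
    simpa using hu.aestronglyMeasurable_weighted hρ (χ := fun _ => 1) continuous_const
  have hloc : LocallyIntegrable (fun t => ∫ x, u x t * ρ x) (volume.restrict (Ioi 0)) := by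
    refine (memLp_top_of_bound hmeas M ?_).locallyIntegrable le_top
    filter_upwards [hM] with t ht
    rw [Real.norm_of_nonneg (integral_nonneg_of_ae ht.2.1)]
    exact ht.2.2.2
  obtain ⟨a, ha⟩ := FracPME.exists_ae_eq_const_of_integral_deriv_mul_eq_zero hloc
    fun η hη hηc hηs => hu.integral_deriv_mul_mass_eq_zero hd0 hs hs' hm hγ hγs (by linarith) hγ₀
      hρ hη hηc hηs
  have haμ : a = μ.real univ := by
    have := FracPME.neBot_ae_inf_nhdsGT_zero
    have hlim := hu.initial (BoundedContinuousFunction.const _ 1)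
    simp only [BoundedContinuousFunction.const_apply, one_mul, integral_const, smul_eq_mul,
      mul_one] at hlim
    refine tendsto_nhds_unique (tendsto_const_nhds.congr' ?_) hlim
    filter_upwards [mem_inf_of_left ha, mem_inf_of_right self_mem_nhdsWithin] with t h1 h2
    exact (h1 h2).symm
  filter_upwards [hM, (ae_restrict_iff' measurableSet_Ioi).2 ha] with t h1 h2
  exact ⟨h1.1, h1.2.2.1, h2.trans haμ⟩
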